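/- Let $F$ be a (real) Banach lattice, $E$ a (real) Banach space, and $S:F\to E$ a bounded linear operator. A sequence $(f_n)_{n\in\mathbb N}$ in $F$ is called disjoint if $|f_m|\wedge|f_n|=0$ whenever $m\neq n$. A sequence $(e_n)$ of norm-one vectors of $F$ is called almost disjoint if there is a disjoint sequence $(f_n)$ in $F$ with $\|f_n-e_n\|\to 0$. A linear subspace $H\subset F$ is called dispersed if it contains no almost disjoint sequence, and anti-dispersed if it contains no infinite-dimensional dispersed linear subspace. A bounded operator $T:X\to Y$ between normed spaces is bounded from below if there is $c>0$ with $\|Tx\|\ge c\|x\|$ for all $x\in X$; it is strictly singular if its restriction to every infinite-dimensional linear subspace of $X$ fails to be bounded from below; it is upper semi-Fredholm (USF) if $\ker T$ is finite-dimensional and $T(X)$ is closed. Subspaces are not assumed to be closed unless this is stated. Then the following conditions are equivalent: (i) $S$ is disjointly strictly singular (DSS), i.e. for every disjoint sequence $(f_n)_{n\in\mathbb N}$ of nonzero vectors of $F$, $S$ is not bounded from below on $\overline{\mathrm{span}}\{f_n\}_{n\in\mathbb N}$; (ii) for every disjoint sequence $(f_n)_{n\in\mathbb N}$ in $F$, the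 restriction of $S$ to $\overline{\mathrm{span}}\{f_n\}_{n\in\mathbb N}$ is strictly singular; (iii) the restriction of $S$ to every anti-dispersed subspace of $F$ is strictly singular; (iv) no restriction of $S$ to a non-dispersed subspace of $F$ is bounded from below; (v) no restriction of $S$ to a closed non-dispersed subspace of $F$ is USF; (vi) every non-dispersed subspace of $F$ contains an almost disjoint sequence $(e_n)$ that is $\rho_S$-null, i.e. satisfies $\|Se_n\|\to 0$. -/

import Mathlib

open Filter Topology

/-- A bounded operator is bounded from below if `c * ‖x‖ ≤ ‖T x‖` for all `x`,
for some constant `c > 0`. -/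
def IsBoundedFromBelow {X Y : Type*} [NormedAddCommGroup X] [NormedSpace ℝ X]
    [NormedAddCommGroup Y] [NormedSpace ℝ Y] (T : X →L[ℝ] Y) : Prop :=
  ∃ c : ℝ, 0 < c ∧ ∀ x : X, c * ‖x‖ ≤ ‖T x‖

/-- Upper semi-Fredholm operators: finite-dimensional kernel and closed range. -/
def IsUpperSemiFredholm {X Y : Type*} [NormedAddCommGroup X] [NormedSpace ℝ X]
    [NormedAddCommGroup Y] [NormedSpace ℝ Y] (T : X →L[ℝ] Y) : Prop :=
  FiniteDimensional ℝ (LinearMap.ker (T : X →ₗ[ℝ] Y)) ∧ IsClosed (Set.range T)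

/-- The restriction of a bounded operator to a subspace of its domain. -/
def restrictTo {X Y : Type*} [NormedAddCommGroup X] [NormedSpace ℝ X]
    [NormedAddCommGroup Y] [NormedSpace ℝ Y] (T : X →L[ℝ] Y) (H : Submodule ℝ X) : H →L[ℝ] Y :=
  T.comp H.subtypeL

/-- Strictly singular operators: no restriction to an infinite-dimensional subspace is
bounded from below. -/
def IsStrictlySingular {X Y : Type*} [NormedAddCommGroup X] [NormedSpace ℝ X]
    [NormedAddCommGroup Y] [NormedSpace ℝ Y] (T : X →L[ℝ] Y) : Prop :=
  ∀ G : Submodule ℝ X, ¬ FiniteDimensional ℝ G → ¬ IsBoundedFromBelow (restrictTo T G)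

/-- A disjoint sequence in a vector lattice: `|f m| ⊓ |f n| = 0` for `m ≠ n`. -/
def IsDisjointSeq {F : Type*} [AddCommGroup F] [Lattice F] (f : ℕ → F) : Prop :=
  ∀ m n : ℕ, m ≠ n → |f m| ⊓ |f n| = 0

/-- The closed linear span of a sequence. -/
def closedSpan {X : Type*} [NormedAddCommGroup X] [NormedSpace ℝ X] (f : ℕ → X) :
    Submodule ℝ X :=
  (Submodule.span ℝ (Set.range f)).topologicalClosure

/-- An almost disjoint sequence: a sequence of unit vectors whose distance to the
corresponding terms of some disjoint sequence tends to `0`. -/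
def IsAlmostDisjointSeq {F : Type*} [NormedAddCommGroup F] [Lattice F] (e : ℕ → F) : Prop :=
  (∀ n, ‖e n‖ = 1) ∧
    ∃ f : ℕ → F, IsDisjointSeq f ∧ Tendsto (fun n => ‖f n - e n‖) atTop (𝓝 0)

/-- A subspace is dispersed if it contains no almost disjoint sequence. -/
def IsDispersed {F : Type*} [NormedAddCommGroup F] [NormedSpace ℝ F] [Lattice F]
    (H : Submodule ℝ F) : Prop :=
  ¬ ∃ e : ℕ → F, (∀ n, e n ∈ H) ∧ IsAlmostDisjointSeq e

/-- A subspace is anti-dispersed if it contains no infinite-dimensional dispersed subspace. -/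
def IsAntiDispersed {F : Type*} [NormedAddCommGroup F] [NormedSpace ℝ F] [Lattice F]
    (H : Submodule ℝ F) : Prop :=
  ¬ ∃ G : Submodule ℝ F, G ≤ H ∧ ¬ FiniteDimensional ℝ G ∧ IsDispersed G

/-- Disjointly strictly singular operators: not bounded from below on the closed span of any
disjoint sequence of nonzero vectors. -/
def IsDisjointlyStrictlySingular {F E : Type*} [NormedAddCommGroup F] [NormedSpace ℝ F]
    [Lattice F] [NormedAddCommGroup E] [NormedSpace ℝ E] (S : F →L[ℝ] E) : Prop :=
  ∀ f : ℕ → F, IsDisjointSeq f → (∀ n, f n ≠ 0) →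
    ¬ IsBoundedFromBelow (restrictTo S (closedSpan f))

/-! The conditions are proved in a cycle, with DSS ⇒ (vi) as the main step. A component of a sum of
disjoint vectors never exceeds the sum in norm, so a unit vector in the span of a disjoint sequence
has controlled coefficients and survives replacing that sequence by a close one in `H`. DSS on tails
supplies such vectors with small image, and a gliding hump makes them almost disjoint. For (vi) ⇒
(v), a null sequence of a USF operator approaches its finite-dimensional kernel; compactness
excludes this for almost disjoint sequences (`not_tendsto_comp`). For (iii) ⇒ (ii), the gliding hump
with the zero operator shows that closed spans of disjoint sequences are anti-dispersed. -/

/-! ### Disjointness in vector lattices and normed lattices. -/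

section DisjointVectors

variable {F : Type*} [NormedAddCommGroup F] [NormedSpace ℝ F] [Lattice F]
  [IsOrderedAddMonoid F] [IsOrderedModule ℝ F]

/-- Subtracting `b` from `a ⊓ (b + c)` leaves something below both `a` and `c`, so `a ⊓ (b + c) ≤
b`. -/
theorem inf_add_eq_zero_of_nonneg {G : Type*} [AddCommGroup G] [Lattice G] [IsOrderedAddMonoid G]
    {a b c : G} (ha : 0 ≤ a) (hb : 0 ≤ b) (hc : 0 ≤ c) (hab : a ⊓ b = 0) (hac : a ⊓ c = 0) :
    a ⊓ (b + c) = 0 := by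
  refine le_antisymm ?_ (le_inf ha (add_nonneg hb hc))
  have h1 : a ⊓ (b + c) - b ≤ a ⊓ c :=
    le_inf ((sub_le_self _ hb).trans inf_le_left) (sub_le_iff_le_add'.2 inf_le_right)
  rw [hac, sub_nonpos] at h1
  rw [← hab]
  exact le_inf inf_le_left h1

/-- Reduces real scalars to natural multiples, where disjointness follows by induction from
additivity. -/
theorem abs_smul_le_nsmul_abs (c : ℝ) (n : ℕ) (hn : |c| ≤ n) (x : F) : |c • x| ≤ n • |x| := by
  have key : ∀ (d : ℝ) (z : F), 0 ≤ d → d ≤ n → |z| = |x| → d • z ≤ n • |x| := by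
    intro d z hd hdn hz
    rw [← hz, ← Nat.cast_smul_eq_nsmul ℝ]
    exact (smul_le_smul_of_nonneg_left (le_abs_self z) hd).trans
      (smul_le_smul_of_nonneg_right hdn (abs_nonneg z))
  rcases le_total 0 c with hc | hc
  · rw [abs_of_nonneg hc] at hn
    refine abs_le'.2 ⟨key c x hc hn rfl, ?_⟩
    rw [← smul_neg]
    exact key c (-x) hc hn (abs_neg x)
  · rw [abs_of_nonpos hc] at hn
    have hc' : 0 ≤ -c := neg_nonneg.2 hc
    refine abs_le'.2 ⟨?_, ?_⟩
    · rw [← neg_smul_neg]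
      exact key (-c) (-x) hc' hn (abs_neg x)
    · rw [← neg_smul]
      exact key (-c) x hc' hn rfl

/-- The disjoint complement of a vector of a vector lattice. -/
def disjointComplement (x : F) : Submodule ℝ F where
  carrier := {z | |x| ⊓ |z| = 0}
  zero_mem' := by simp
  add_mem' := by
    intro a b ha hb
    refine le_antisymm ?_ (le_inf (abs_nonneg _) (abs_nonneg _))
    rw [← inf_add_eq_zero_of_nonneg (abs_nonneg x) (abs_nonneg a) (abs_nonneg b) ha hb]
    exact inf_le_inf_left _ (abs_add_le a b)
  smul_mem' := by
    intro c z hz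
    obtain ⟨n, hn⟩ := exists_nat_ge |c|
    have h : ∀ m : ℕ, |x| ⊓ (m • |z|) = 0 := by
      intro m
      induction m with
      | zero => simp
      | succ m ih =>
        rw [succ_nsmul]
        exact inf_add_eq_zero_of_nonneg (abs_nonneg _) (nsmul_nonneg (abs_nonneg _) _)
          (abs_nonneg _) ih hz
    refine le_antisymm ?_ (le_inf (abs_nonneg _) (abs_nonneg _))
    rw [← h n]
    exact inf_le_inf_left _ (abs_smul_le_nsmul_abs c n hn z)

theorem mem_disjointComplement {x z : F} : z ∈ disjointComplement x ↔ |x| ⊓ |z| = 0 := Iff.rfl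

theorem mem_disjointComplement_comm {x z : F} :
    z ∈ disjointComplement x ↔ x ∈ disjointComplement z := by
  rw [mem_disjointComplement, mem_disjointComplement, inf_comm]

/-- The excess `|u| - |u + v|` lies below both `|u|` and `|v|`, hence below `0`. -/
theorem abs_le_abs_add_of_mem_disjointComplement {u v : F} (h : v ∈ disjointComplement u) :
    |u| ≤ |u + v| := by
  have hu : |u| ≤ |u + v| + |v| := by
    have := abs_add_le (u + v) (-v)
    rwa [add_neg_cancel_right, abs_neg] at this
  have h1 : |u| - |v| ≤ |u + v| := sub_le_iff_le_add.2 hu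
  have h2 : |u| - |u + v| ≤ |u| ⊓ |v| :=
    le_inf (sub_le_self _ (abs_nonneg _)) (sub_le_comm.1 h1)
  rw [mem_disjointComplement.1 h] at h2
  exact sub_nonpos.1 h2

theorem norm_le_norm_add_of_mem_disjointComplement [HasSolidNorm F] {u v : F}
    (h : v ∈ disjointComplement u) : ‖u‖ ≤ ‖u + v‖ :=
  norm_le_norm_of_abs_le_abs (abs_le_abs_add_of_mem_disjointComplement h)

theorem IsDisjointSeq.mem_disjointComplement_of_mem_span {f : ℕ → F} (hf : IsDisjointSeq f)
    {A B : Set ℕ} (hAB : Disjoint A B) {x y : F} (hx : x ∈ Submodule.span ℝ (f '' A))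
    (hy : y ∈ Submodule.span ℝ (f '' B)) : y ∈ disjointComplement x := by
  have h1 : ∀ m ∈ A, y ∈ disjointComplement (f m) := by
    intro m hm
    refine (Submodule.span_le.2 ?_) hy
    rintro _ ⟨n, hn, rfl⟩
    exact hf m n (fun h => Set.disjoint_left.1 hAB hm (h ▸ hn))
  rw [mem_disjointComplement_comm]
  refine (Submodule.span_le.2 ?_) hx
  rintro _ ⟨m, hm, rfl⟩
  exact mem_disjointComplement_comm.1 (h1 m hm)

theorem IsDisjointSeq.norm_smul_le_norm_sum [HasSolidNorm F] {f : ℕ → F} (hf : IsDisjointSeq f)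
    (s : Finset ℕ) (a : ℕ → ℝ) {n : ℕ} (hn : n ∈ s) :
    ‖a n • f n‖ ≤ ‖∑ i ∈ s, a i • f i‖ := by
  rw [← Finset.add_sum_erase s _ hn]
  refine norm_le_norm_add_of_mem_disjointComplement
    (hf.mem_disjointComplement_of_mem_span (A := {n}) (B := (s.erase n : Finset ℕ)) ?_ ?_ ?_)
  · simp
  · exact Submodule.smul_mem _ _ (Submodule.subset_span ⟨n, rfl, rfl⟩)
  · exact Submodule.sum_mem _ fun i hi =>
      Submodule.smul_mem _ _ (Submodule.subset_span ⟨i, hi, rfl⟩)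

end DisjointVectors

theorem IsDisjointSeq.comp_injective {F : Type*} [AddCommGroup F] [Lattice F] {f : ℕ → F}
    (hf : IsDisjointSeq f) {φ : ℕ → ℕ} (hφ : Function.Injective φ) :
    IsDisjointSeq fun n => f (φ n) :=
  fun _ _ hmn => hf _ _ fun h => hmn (hφ h)

theorem norm_inv_norm_smul_sub_self {X : Type*} [NormedAddCommGroup X] [NormedSpace ℝ X] {x : X}
    (hx : x ≠ 0) : ‖‖x‖⁻¹ • x - x‖ = |1 - ‖x‖| := by
  have h : ‖x‖ ≠ 0 := norm_ne_zero_iff.2 hx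
  calc ‖‖x‖⁻¹ • x - x‖ = ‖(‖x‖⁻¹ - 1) • x‖ := by rw [sub_smul, one_smul]
    _ = |(‖x‖⁻¹ - 1) * ‖x‖| := by rw [norm_smul, abs_mul, abs_norm, Real.norm_eq_abs]
    _ = |1 - ‖x‖| := by rw [sub_mul, one_mul, inv_mul_cancel₀ h]

theorem exists_finset_mem_span_image_of_mem_span_image {X ι : Type*} [AddCommGroup X] [Module ℝ X]
    {f : ι → X} {A : Set ι} {y : X} (hy : y ∈ Submodule.span ℝ (f '' A)) :
    ∃ (s : Finset ι) (a : ι → ℝ), (s : Set ι) ⊆ A ∧ ∑ i ∈ s, a i • f i = y := by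
  obtain ⟨l, hl, rfl⟩ := (Finsupp.mem_span_image_iff_linearCombination ℝ).1 hy
  exact ⟨l.support, l, hl, rfl⟩

/-- Otherwise the quotient map by `W` would embed `G` into the image of `V`. -/
theorem Submodule.inf_ne_bot_of_le_sup_of_not_finiteDimensional {X : Type*} [AddCommGroup X]
    [Module ℝ X] {G W V : Submodule ℝ X} [FiniteDimensional ℝ V] (hG : ¬ FiniteDimensional ℝ G)
    (h : G ≤ W ⊔ V) : G ⊓ W ≠ ⊥ := by
  intro hbot
  refine hG ?_
  have hmem : ∀ x : G, (W.mkQ ∘ₗ G.subtype) x ∈ V.map W.mkQ := by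
    intro x
    obtain ⟨w, hw, v, hv, hx⟩ := Submodule.mem_sup.1 (h x.2)
    refine ⟨v, hv, ?_⟩
    rw [LinearMap.comp_apply, Submodule.subtype_apply, ← hx, map_add,
      Submodule.mkQ_apply W w, (Submodule.Quotient.mk_eq_zero W).2 hw, zero_add]
  refine FiniteDimensional.of_injective ((W.mkQ ∘ₗ G.subtype).codRestrict _ hmem) ?_
  rw [← LinearMap.ker_eq_bot, LinearMap.ker_codRestrict, LinearMap.ker_eq_bot']
  intro x hx
  have hxW : (x : X) ∈ W := (Submodule.Quotient.mk_eq_zero W).1 hx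
  have : (x : X) ∈ G ⊓ W := ⟨x.2, hxW⟩
  rw [hbot, Submodule.mem_bot] at this
  exact Subtype.ext this

/-! ### Operators bounded from below and upper semi-Fredholm operators. -/

section Operators

variable {X Y : Type*} [NormedAddCommGroup X] [NormedSpace ℝ X] [NormedAddCommGroup Y]
  [NormedSpace ℝ Y]

theorem IsBoundedFromBelow.isUpperSemiFredholm [CompleteSpace X] {T : X →L[ℝ] Y}
    (hT : IsBoundedFromBelow T) : IsUpperSemiFredholm T := by
  obtain ⟨c, hc, hcT⟩ := hT
  lift c to NNReal using hc.le
  have hanti : AntilipschitzWith c⁻¹ T := by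
    refine T.antilipschitz_of_bound fun x => ?_
    rw [NNReal.coe_inv, ← div_eq_inv_mul, le_div_iff₀' hc]
    exact hcT x
  refine ⟨?_, hanti.isClosed_range T.uniformContinuous⟩
  have hker : LinearMap.ker (T : X →ₗ[ℝ] Y) = ⊥ := LinearMap.ker_eq_bot.2 hanti.injective
  rw [hker]
  infer_instance

theorem IsBoundedFromBelow.restrictTo_topologicalClosure {T : X →L[ℝ] Y} {H : Submodule ℝ X}
    (hT : IsBoundedFromBelow (restrictTo T H)) :
    IsBoundedFromBelow (restrictTo T H.topologicalClosure) := by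
  obtain ⟨c, hc, hcT⟩ := hT
  refine ⟨c, hc, fun x => ?_⟩
  have hcl : IsClosed {x : X | c * ‖x‖ ≤ ‖T x‖} :=
    isClosed_le (by fun_prop) (by fun_prop)
  exact closure_minimal (s := (H : Set X)) (fun y hy => hcT ⟨y, hy⟩) hcl x.2

/-- Along a sequence that an upper semi-Fredholm operator maps to a null sequence, the distance
to the kernel tends to zero. -/
theorem IsUpperSemiFredholm.exists_tendsto_sub_ker [CompleteSpace X] [CompleteSpace Y]
    {T : X →L[ℝ] Y} (hT : IsUpperSemiFredholm T) {e : ℕ → X}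
    (he : Tendsto (fun n => ‖T (e n)‖) atTop (𝓝 0)) :
    ∃ q : ℕ → LinearMap.ker (T : X →ₗ[ℝ] Y), Tendsto (fun n => e n - q n) atTop (𝓝 0) := by
  have hcl : IsClosed (LinearMap.range (T : X →ₗ[ℝ] Y) : Set Y) := hT.2
  have : CompleteSpace (LinearMap.range (T : X →ₗ[ℝ] Y)) := hcl.completeSpace_coe
  let T' : X →L[ℝ] LinearMap.range (T : X →ₗ[ℝ] Y) := T.codRestrict _ fun x => ⟨x, rfl⟩
  have hsurj : Function.Surjective T' := by
    rintro ⟨_, x, rfl⟩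
    exact ⟨x, rfl⟩
  -- Open mapping theorem: subtracting a preimage of `T (e n)` of norm at most `C * ‖T (e n)‖` lands
  -- in the kernel.
  obtain ⟨C, -, hC⟩ := T'.exists_preimage_norm_le hsurj
  choose g hg hgC using hC
  refine ⟨fun n => ⟨e n - g (T' (e n)), ?_⟩, ?_⟩
  · have h1 : T (g (T' (e n))) = T (e n) := congrArg Subtype.val (hg (T' (e n)))
    simp [h1]
  · simp only [sub_sub_cancel]
    have h1 : Tendsto (fun n => C * ‖T (e n)‖) atTop (𝓝 0) := by simpa using he.const_mul C
    exact squeeze_zero_norm (fun n => hgC (T' (e n))) h1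

theorem closedSpan_le_sup (f : ℕ → X) (k : ℕ) :
    closedSpan f ≤ (Submodule.span ℝ (f '' Set.Ici k)).topologicalClosure ⊔
      Submodule.span ℝ (f '' Set.Iio k) := by
  have : FiniteDimensional ℝ (Submodule.span ℝ (f '' Set.Iio k)) :=
    FiniteDimensional.span_of_finite ℝ ((Set.finite_Iio k).image f)
  refine Submodule.topologicalClosure_minimal _ (Submodule.span_le.2 ?_)
    (Submodule.isClosed_sup_finiteDimensional _ _ (Submodule.isClosed_topologicalClosure _))
  rintro _ ⟨n, rfl⟩
  rcases lt_or_ge n k with hn | hn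
  · exact Submodule.mem_sup_right (Submodule.subset_span ⟨n, hn, rfl⟩)
  · exact Submodule.mem_sup_left
      (Submodule.le_topologicalClosure _ (Submodule.subset_span ⟨n, hn, rfl⟩))

/-- An operator not bounded from below on a closed span is arbitrarily small on some unit vector
of the span. -/
theorem exists_norm_eq_one_norm_apply_lt {S : X →L[ℝ] Y} {f : ℕ → X}
    (h : ¬ IsBoundedFromBelow (restrictTo S (closedSpan f))) {δ : ℝ} (hδ : 0 < δ) :
    ∃ y ∈ Submodule.span ℝ (Set.range f), ‖y‖ = 1 ∧ ‖S y‖ < δ := by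
  by_contra! hcon
  refine h ⟨δ, hδ, fun x => ?_⟩
  have hcl : IsClosed {x : X | δ * ‖x‖ ≤ ‖S x‖} :=
    isClosed_le (by fun_prop) (by fun_prop)
  refine closure_minimal (s := (Submodule.span ℝ (Set.range f) : Set X)) ?_ hcl x.2
  intro y hy
  rcases eq_or_ne y 0 with rfl | hy0
  · simp
  have h1 := hcon _ (Submodule.smul_mem _ ‖y‖⁻¹ hy) (norm_smul_inv_norm (𝕜 := ℝ) hy0)
  rw [map_smul, norm_smul, norm_inv, norm_norm, ← div_eq_inv_mul,
    le_div_iff₀ (norm_pos_iff.2 hy0)] at h1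
  exact h1

end Operators

/-- The disjoint approximants would share the limit `p`; continuity of the lattice operations gives
`|p| ⊓ |p| = 0`, while `‖p‖ = 1`. -/
theorem IsAlmostDisjointSeq.not_tendsto_comp {F : Type*} [NormedAddCommGroup F]
    [Lattice F] [IsOrderedAddMonoid F] [HasSolidNorm F] {e : ℕ → F}
    (he : IsAlmostDisjointSeq e) {φ : ℕ → ℕ} (hφ : StrictMono φ) (p : F) :
    ¬ Tendsto (fun n => e (φ n)) atTop (𝓝 p) := by
  intro hp
  obtain ⟨he1, f, hf, hfe⟩ := he
  have hfp : Tendsto (fun n => f (φ n)) atTop (𝓝 p) := by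
    have h1 := (tendsto_zero_iff_norm_tendsto_zero.2 hfe).comp hφ.tendsto_atTop
    have h2 := h1.add hp
    rw [zero_add] at h2
    exact h2.congr fun n => sub_add_cancel _ _
  have habs : Continuous fun x : F => |x| := continuous_id.sup continuous_neg
  have h1 := (habs.tendsto p).comp hfp
  have h2 := h1.inf_nhds (h1.comp (tendsto_add_atTop_nat 1))
  have h3 : |p| ⊓ |p| = 0 := by
    refine tendsto_nhds_unique h2 (tendsto_const_nhds.congr fun n => ?_)
    exact (hf _ _ (hφ (Nat.lt_succ_self n)).ne).symm
  rw [inf_idem] at h3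
  have h4 : ‖p‖ = 0 := by rw [← norm_abs_eq_norm, h3, norm_zero]
  have h5 : ‖p‖ = 1 := tendsto_nhds_unique hp.norm (by simp [he1])
  exact one_ne_zero (h5.symm.trans h4)

/-! ### Constructing and excluding almost disjoint sequences. -/

section BanachLattice

variable {F : Type*} [NormedAddCommGroup F] [NormedSpace ℝ F] [Lattice F]
  [IsOrderedAddMonoid F]
  {E : Type*} [NormedAddCommGroup E] [NormedSpace ℝ E]

/-- A gliding hump argument producing almost disjoint sequences. -/
theorem IsDisjointSeq.exists_isAlmostDisjointSeq_tendsto_zero [IsOrderedModule ℝ F]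
    (S : F →L[ℝ] E) {H : Submodule ℝ F}
    {f : ℕ → F} (hf : IsDisjointSeq f)
    (h : ∀ ε : ℝ, 0 < ε → ∀ k : ℕ, ∃ x ∈ H, ‖x‖ = 1 ∧ ‖S x‖ < ε ∧
      ∃ y ∈ Submodule.span ℝ (f '' Set.Ici k), ‖y - x‖ < ε) :
    ∃ e : ℕ → F, (∀ n, e n ∈ H) ∧ IsAlmostDisjointSeq e ∧
      Tendsto (fun n => ‖S (e n)‖) atTop (𝓝 0) := by
  have h' : ∀ n k : ℕ, ∃ (x y : F) (l : ℕ), x ∈ H ∧ ‖x‖ = 1 ∧ ‖S x‖ < 1 / ((n : ℝ) + 1) ∧ k ≤ l ∧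
      y ∈ Submodule.span ℝ (f '' Set.Ico k l) ∧ ‖y - x‖ < 1 / ((n : ℝ) + 1) := by
    intro n k
    obtain ⟨x, hxH, hx1, hSx, y, hy, hyx⟩ := h _ (Nat.one_div_pos_of_nat (n := n)) k
    obtain ⟨s, a, hs, rfl⟩ := exists_finset_mem_span_image_of_mem_span_image hy
    refine ⟨x, _, k + (s.sup id + 1), hxH, hx1, hSx, Nat.le_add_right _ _, ?_, hyx⟩
    refine Submodule.sum_mem _ fun i hi => Submodule.smul_mem _ _ (Submodule.subset_span ⟨i, ?_, rfl⟩)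
    have : i ≤ s.sup id := Finset.le_sup (f := id) hi
    exact ⟨hs hi, by omega⟩
  choose X Y L hXH hX1 hSX hL hY hYX using h'
  -- Each block starts where the previous one ends, so the supports are disjoint.
  let κ : ℕ → ℕ := fun n => Nat.rec 0 (fun n k => L n k) n
  have hκ : Monotone κ := monotone_nat_of_le_succ fun n => hL n (κ n)
  have hYκ : ∀ n, Y n (κ n) ∈ Submodule.span ℝ (f '' Set.Ico (κ n) (κ (n + 1))) :=
    fun n => hY n (κ n)
  refine ⟨fun n => X n (κ n), fun n => hXH _ _, ⟨fun n => hX1 _ _, fun n => Y n (κ n), ?_, ?_⟩, ?_⟩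
  · intro m n hmn
    exact hf.mem_disjointComplement_of_mem_span (hκ.pairwise_disjoint_on_Ico_succ hmn)
      (hYκ m) (hYκ n)
  · exact squeeze_zero (fun _ => norm_nonneg _) (fun n => (hYX n (κ n)).le)
      tendsto_one_div_add_atTop_nhds_zero_nat
  · exact squeeze_zero (fun _ => norm_nonneg _) (fun n => (hSX n (κ n)).le)
      tendsto_one_div_add_atTop_nhds_zero_nat

/-- A sequence of unit vectors close to a finite-dimensional subspace is not almost disjoint. -/
theorem IsAlmostDisjointSeq.not_tendsto_sub_finiteDimensional [HasSolidNorm F] {e : ℕ → F}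
    (he : IsAlmostDisjointSeq e) (N : Submodule ℝ F) [FiniteDimensional ℝ N] (q : ℕ → N) :
    ¬ Tendsto (fun n => e n - q n) atTop (𝓝 0) := by
  intro h
  have : ProperSpace N := FiniteDimensional.proper ℝ N
  obtain ⟨C, hC⟩ := h.norm.bddAbove_range
  have hb : ∀ n, q n ∈ Metric.closedBall (0 : N) (1 + C) := by
    intro n
    rw [mem_closedBall_zero_iff]
    have h1 : ‖e n - q n‖ ≤ C := hC ⟨n, rfl⟩
    have h2 : ‖(q n : F)‖ ≤ ‖e n‖ + ‖e n - q n‖ := by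
      have := norm_sub_le (e n) (e n - q n)
      rwa [sub_sub_cancel] at this
    rw [he.1 n] at h2
    exact h2.trans (by linarith)
  obtain ⟨p, -, φ, hφ, hp⟩ := tendsto_subseq_of_bounded Metric.isBounded_closedBall hb
  refine he.not_tendsto_comp hφ (p : F) ?_
  have h1 := (h.comp hφ.tendsto_atTop).add ((continuous_subtype_val.tendsto p).comp hp)
  rw [zero_add] at h1
  exact h1.congr fun n => sub_add_cancel _ _

theorem not_finiteDimensional_of_not_isDispersed [HasSolidNorm F] {H : Submodule ℝ F}
    (hH : ¬ IsDispersed H) : ¬ FiniteDimensional ℝ H := by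
  intro hfin
  obtain ⟨e, heH, he⟩ := not_not.1 hH
  exact he.not_tendsto_sub_finiteDimensional H (fun n => ⟨e n, heH n⟩) (by simp)

theorem IsDisjointSeq.not_isDispersed_closedSpan [IsOrderedModule ℝ F] {f : ℕ → F}
    (hf : IsDisjointSeq f) (hf0 : ∀ n, f n ≠ 0) : ¬ IsDispersed (closedSpan f) := by
  refine not_not.2 ⟨fun n => ‖f n‖⁻¹ • f n, fun n => ?_, fun n => ?_, _, fun m n hmn => ?_,
    (by simp : Tendsto (fun n => ‖‖f n‖⁻¹ • f n - ‖f n‖⁻¹ • f n‖) atTop (𝓝 0))⟩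
  · exact Submodule.smul_mem _ _
      (Submodule.le_topologicalClosure _ (Submodule.subset_span ⟨n, rfl⟩))
  · exact norm_smul_inv_norm (𝕜 := ℝ) (hf0 n)
  · have h1 : f n ∈ disjointComplement (f m) := hf m n hmn
    exact Submodule.smul_mem _ _ (mem_disjointComplement_comm.1
      (Submodule.smul_mem _ ‖f m‖⁻¹ (mem_disjointComplement_comm.1 h1)))

/-- Closed tail spans have finite codimension, so an infinite-dimensional `G` meets each of them. -/
theorem IsDisjointSeq.isAntiDispersed_closedSpan [IsOrderedModule ℝ F] {f : ℕ → F}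
    (hf : IsDisjointSeq f) : IsAntiDispersed (closedSpan f) := by
  rintro ⟨G, hG, hGfin, hGd⟩
  refine hGd ?_
  suffices h : _ from
    let ⟨e, heG, he, _⟩ := hf.exists_isAlmostDisjointSeq_tendsto_zero (0 : F →L[ℝ] F) (H := G) h
    ⟨e, heG, he⟩
  intro δ hδ k
  have : FiniteDimensional ℝ (Submodule.span ℝ (f '' Set.Iio k)) :=
    FiniteDimensional.span_of_finite ℝ ((Set.finite_Iio k).image f)
  obtain ⟨x, ⟨hxG, hxW⟩, hx0⟩ := Submodule.exists_mem_ne_zero_of_ne_bot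
    (Submodule.inf_ne_bot_of_le_sup_of_not_finiteDimensional hGfin
      (hG.trans (closedSpan_le_sup f k)))
  have hxW' := Submodule.smul_mem _ ‖x‖⁻¹ hxW
  obtain ⟨y, hy, hyx⟩ := Metric.mem_closure_iff.1 hxW' δ hδ
  refine ⟨‖x‖⁻¹ • x, Submodule.smul_mem _ _ hxG, norm_smul_inv_norm (𝕜 := ℝ) hx0, by simpa using hδ,
    y, hy, by rwa [← dist_eq_norm, dist_comm]⟩

variable [IsOrderedModule ℝ F] [HasSolidNorm F]

/-- Coefficients of a unit vector in the span of a disjoint sequence transfer to a nearby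
sequence. -/
theorem IsDisjointSeq.norm_sum_smul_sub_sum_smul_le {e f : ℕ → F} (hf : IsDisjointSeq f)
    (hfn : ∀ n, 1 / 2 ≤ ‖f n‖) (s : Finset ℕ) (a : ℕ → ℝ) (h1 : ‖∑ i ∈ s, a i • f i‖ = 1) :
    ‖∑ i ∈ s, a i • f i - ∑ i ∈ s, a i • e i‖ ≤ 2 * ∑ i ∈ s, ‖f i - e i‖ := by
  rw [← Finset.sum_sub_distrib, Finset.mul_sum]
  refine norm_sum_le_of_le _ fun i hi => ?_
  rw [← smul_sub, norm_smul]
  refine mul_le_mul_of_nonneg_right ?_ (norm_nonneg _)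
  -- From `‖a i • f i‖ ≤ 1` and `1 / 2 ≤ ‖f i‖`, each coefficient is at most `2` in modulus.
  have h2 := hf.norm_smul_le_norm_sum s a hi
  rw [h1, norm_smul] at h2
  nlinarith [hfn i, norm_nonneg (a i)]

theorem IsDisjointlyStrictlySingular.exists_isAlmostDisjointSeq_tendsto_zero {S : F →L[ℝ] E}
    (hS : IsDisjointlyStrictlySingular S) {H : Submodule ℝ F} (hH : ¬ IsDispersed H) :
    ∃ e : ℕ → F, (∀ n, e n ∈ H) ∧ IsAlmostDisjointSeq e ∧
      Tendsto (fun n => ‖S (e n)‖) atTop (𝓝 0) := by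
  obtain ⟨e₀, he₀H, he₀1, f₀, hf₀, hfe₀⟩ := not_not.1 hH
  obtain ⟨φ, hφ, hφlt⟩ := extraction_forall_of_eventually
    (P := fun n k => ‖f₀ k - e₀ k‖ < (1 / 2 : ℝ) ^ (n + 1))
    fun n => hfe₀.eventually_lt_const (by positivity)
  set e : ℕ → F := fun n => e₀ (φ n)
  set f : ℕ → F := fun n => f₀ (φ n)
  have hf : IsDisjointSeq f := hf₀.comp_injective hφ.injective
  have hfe : ∀ n, ‖f n - e n‖ ≤ (1 / 2 : ℝ) ^ (n + 1) := fun n => (hφlt n).le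
  have hsum : Summable fun n => ‖f n - e n‖ :=
    .of_nonneg_of_le (fun _ => norm_nonneg _) hfe
      ((summable_nat_add_iff 1).2 (summable_geometric_of_lt_one (by norm_num) (by norm_num)))
  have hfn : ∀ n, 1 / 2 ≤ ‖f n‖ := by
    intro n
    have h1 : ‖f n - e n‖ ≤ 1 / 2 :=
      (hfe n).trans (pow_le_of_le_one (by norm_num) (by norm_num) n.succ_ne_zero)
    have h2 := norm_sub_norm_le (e n) (f n)
    rw [norm_sub_rev, show ‖e n‖ = 1 from he₀1 _] at h2
    linarith
  have hf0 : ∀ n, f n ≠ 0 := fun n h => by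
    have := hfn n
    rw [h, norm_zero] at this
    norm_num at this
  refine hf.exists_isAlmostDisjointSeq_tendsto_zero S fun ε hε k => ?_
  -- One `η` pays for moving `y` to `z`, another for normalizing `z`; `η < 1` keeps `z` nonzero.
  obtain ⟨η, hη, hη1, hηε, hηS⟩ : ∃ η : ℝ, 0 < η ∧ η < 1 ∧ 2 * η < ε ∧
      ‖S‖ * (2 * η) + η < ε := by
    have hlim : Tendsto (fun η : ℝ => ‖S‖ * (2 * η) + η) (𝓝[>] 0) (𝓝 0) := by
      have : Continuous fun η : ℝ => ‖S‖ * (2 * η) + η := by fun_prop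
      simpa using (this.tendsto 0).mono_left nhdsWithin_le_nhds
    have hid : Tendsto (fun η : ℝ => 2 * η) (𝓝[>] 0) (𝓝 0) := by
      have : Continuous fun η : ℝ => 2 * η := by fun_prop
      simpa using (this.tendsto 0).mono_left nhdsWithin_le_nhds
    obtain ⟨η, h1, h2, h3, h4⟩ := ((eventually_mem_nhdsWithin (a := (0 : ℝ)) (s := Set.Ioi 0)).and
      (((hid.eventually_lt_const (zero_lt_two' ℝ))).and ((hid.eventually_lt_const hε).and
        (hlim.eventually_lt_const hε)))).exists
    exact ⟨η, h1, by linarith, h3, h4⟩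
  -- The half absorbs the coefficient bound `2`.
  obtain ⟨t, ht⟩ := summable_iff_vanishing_norm.1 hsum (η / 2) (by positivity)
  set K : ℕ := k + (t.sup id + 1)
  obtain ⟨y, hy, hy1, hSy⟩ := exists_norm_eq_one_norm_apply_lt
    (hS (fun n => f (K + n)) (hf.comp_injective (add_right_injective K)) fun n => hf0 _) hη
  have hyK : y ∈ Submodule.span ℝ (f '' Set.Ici K) := by
    refine Submodule.span_mono ?_ hy
    rintro _ ⟨n, rfl⟩
    exact ⟨K + n, Nat.le_add_right _ _, rfl⟩
  obtain ⟨s, a, hs, rfl⟩ := exists_finset_mem_span_image_of_mem_span_image hyK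
  set y : F := ∑ i ∈ s, a i • f i
  set z : F := ∑ i ∈ s, a i • e i
  have hyz : ‖y - z‖ < η := by
    have hst : Disjoint s t := by
      refine Finset.disjoint_left.2 fun i hi hit => ?_
      have h1 : K ≤ i := hs hi
      have h2 : i ≤ t.sup id := Finset.le_sup (f := id) hit
      omega
    have h1 := (le_abs_self _).trans_lt (ht s hst)
    have h2 := hf.norm_sum_smul_sub_sum_smul_le (e := e) hfn s a hy1
    linarith
  have hz : |1 - ‖z‖| < η := by
    rw [← hy1]
    exact (abs_norm_sub_norm_le y z).trans_lt hyz
  have hz0 : z ≠ 0 := by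
    intro h
    rw [h, norm_zero, sub_zero, abs_one] at hz
    linarith
  have hzH : z ∈ H := Submodule.sum_mem _ fun i _ => Submodule.smul_mem _ _ (he₀H _)
  have hyx : ‖y - ‖z‖⁻¹ • z‖ < 2 * η := by
    have h1 := norm_sub_le_norm_sub_add_norm_sub y z (‖z‖⁻¹ • z)
    rw [norm_sub_rev z, norm_inv_norm_smul_sub_self hz0] at h1
    linarith
  refine ⟨‖z‖⁻¹ • z, Submodule.smul_mem _ _ hzH, norm_smul_inv_norm (𝕜 := ℝ) hz0, ?_, y, ?_,
    hyx.trans hηε⟩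
  · have h1 : ‖S (‖z‖⁻¹ • z)‖ ≤ ‖S (y - ‖z‖⁻¹ • z)‖ + ‖S y‖ := by
      have := norm_sub_le (S y) (S (y - ‖z‖⁻¹ • z))
      rw [← map_sub, sub_sub_cancel] at this
      linarith
    have h2 : ‖S (y - ‖z‖⁻¹ • z)‖ ≤ ‖S‖ * (2 * η) :=
      (S.le_opNorm _).trans (mul_le_mul_of_nonneg_left hyx.le (norm_nonneg _))
    linarith
  · refine Submodule.span_mono (Set.image_mono (Set.Ici_subset_Ici.2 ?_)) hyK
    exact Nat.le_add_right _ _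

end BanachLattice

theorem IsDispersed.mono {F : Type*} [NormedAddCommGroup F] [NormedSpace ℝ F] [Lattice F]
    {G H : Submodule ℝ F} (hGH : G ≤ H) (hH : IsDispersed H) : IsDispersed G :=
  fun ⟨e, heG, he⟩ => hH ⟨e, fun n => hGH (heG n), he⟩

/-- Almost disjoint sequences obstruct upper semi-Fredholm restrictions on which they are null. -/
theorem IsAlmostDisjointSeq.not_isUpperSemiFredholm {F : Type*} [NormedAddCommGroup F]
    [NormedSpace ℝ F] [CompleteSpace F] [Lattice F] [IsOrderedAddMonoid F] [HasSolidNorm F]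
    {E : Type*} [NormedAddCommGroup E] [NormedSpace ℝ E] [CompleteSpace E] {S : F →L[ℝ] E}
    {H : Submodule ℝ F} (hH : IsClosed (H : Set F)) {e : ℕ → F} (heH : ∀ n, e n ∈ H)
    (he : IsAlmostDisjointSeq e) (hSe : Tendsto (fun n => ‖S (e n)‖) atTop (𝓝 0)) :
    ¬ IsUpperSemiFredholm (restrictTo S H) := by
  intro hU
  have : CompleteSpace H := hH.completeSpace_coe
  have := hU.1
  obtain ⟨q, hq⟩ := hU.exists_tendsto_sub_ker (e := fun n => ⟨e n, heH n⟩) hSe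
  refine he.not_tendsto_sub_finiteDimensional
    ((LinearMap.ker (restrictTo S H : H →ₗ[ℝ] E)).map H.subtype)
    (fun n => ⟨(q n : H), Submodule.mem_map_of_mem (q n).2⟩) ?_
  exact (continuous_subtype_val.tendsto (0 : H)).comp hq

theorem mainTheorem12
    {F : Type*} [NormedAddCommGroup F] [NormedSpace ℝ F] [CompleteSpace F]
    [Lattice F] [IsOrderedAddMonoid F] [IsOrderedModule ℝ F] [HasSolidNorm F]
    {E : Type*} [NormedAddCommGroup E] [NormedSpace ℝ E] [CompleteSpace E]
    (S : F →L[ℝ] E) :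
    List.TFAE [
      IsDisjointlyStrictlySingular S,
      ∀ f : ℕ → F, IsDisjointSeq f → IsStrictlySingular (restrictTo S (closedSpan f)),
      ∀ H : Submodule ℝ F, IsAntiDispersed H → IsStrictlySingular (restrictTo S H),
      ∀ H : Submodule ℝ F, ¬ IsDispersed H → ¬ IsBoundedFromBelow (restrictTo S H),
      ∀ H : Submodule ℝ F, IsClosed (H : Set F) → ¬ IsDispersed H →
        ¬ IsUpperSemiFredholm (restrictTo S H),
      ∀ H : Submodule ℝ F, ¬ IsDispersed H →
        ∃ e : ℕ → F, (∀ n, e n ∈ H) ∧ IsAlmostDisjointSeq e ∧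
          Tendsto (fun n => ‖S (e n)‖) atTop (𝓝 0)] := by
  tfae_have 1 → 6 := fun hS H hH => hS.exists_isAlmostDisjointSeq_tendsto_zero hH
  tfae_have 6 → 5 := fun h H hcl hH => by
    obtain ⟨e, heH, he, hSe⟩ := h H hH
    exact he.not_isUpperSemiFredholm hcl heH hSe
  tfae_have 5 → 4 := fun h H hH hb => by
    -- Passing to the closure gives the completeness that makes a bounded-below restriction USF.
    have : CompleteSpace H.topologicalClosure :=
      H.isClosed_topologicalClosure.completeSpace_coe
    exact h H.topologicalClosure H.isClosed_topologicalClosure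
      (fun hd => hH (hd.mono H.le_topologicalClosure))
      hb.restrictTo_topologicalClosure.isUpperSemiFredholm
  tfae_have 4 → 3 := fun h H hH G hG ⟨c, hc, hcS⟩ => by
    have hGfin : ¬ FiniteDimensional ℝ (G.map H.subtype) := fun hfin =>
      hG ((G.equivMapOfInjective H.subtype H.injective_subtype).symm.finiteDimensional)
    refine h (G.map H.subtype) (fun hd => hH ⟨_, Submodule.map_subtype_le H G, hGfin, hd⟩)
      ⟨c, hc, ?_⟩
    rintro ⟨_, x, hx, rfl⟩
    exact hcS ⟨x, hx⟩
  tfae_have 3 → 2 := fun h f hf => h _ hf.isAntiDispersed_closedSpan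
  tfae_have 2 → 1 := fun h f hf hf0 ⟨c, hc, hcS⟩ => by
    -- The closed span is non-dispersed, hence infinite-dimensional, so strict singularity applies
    -- to the whole of it.
    refine h f hf ⊤ (fun hfin => not_finiteDimensional_of_not_isDispersed
      (hf.not_isDispersed_closedSpan hf0) (Submodule.topEquiv.finiteDimensional))
      ⟨c, hc, fun x => hcS x.1⟩
  tfae_finish
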